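/- Rings are associative with $1\neq 0$, and a ring $A$ is called torsion-free if $0$ is the only element of $A$ of finite additive order; $A^*$ denotes its group of units. Let $G$ be a finite abelian group. The following are equivalent: (i) $G\cong A^*$ for some torsion-free ring $A$; (ii) $G\cong A^*$ for some commutative torsion-free ring $A$; (iii) $$G\cong(\mathbb{Z}/2\mathbb{Z})^a\times(\mathbb{Z}/4\mathbb{Z})^b\times(\mathbb{Z}/3\mathbb{Z})^c$$ for some integers $a,b,c\ge 0$ with $a+b\ge 1$, and with $a\ge 1$ if $c\ge 1$. In particular, the possible values of $|A^*|$, where $A$ ranges over the torsion-free rings whose unit group is finite and abelian, are exactly the integers $2^d3^c$ with $d\ge 1$ and $c\ge 0$; the same values occur if $A$ is restricted to be commutative. -/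

import Mathlib

universe u v

/-!
The point of the classification is that a torsion-free ring with finitely many units contains few
roots of unity. Let `g` be a unit of order `n` of such a ring `A`, and suppose that `Φₙ(g)` kills
some nonzero `D(g)`, with `D` an integer polynomial. As `A` is torsion-free, an integer polynomial
that vanishes at `g` is then divisible by `Φₙ` (`cyclotomic_dvd_of_aeval_eq_zero`). If `f` is an
integer polynomial invertible modulo a polynomial that vanishes at `g`, then `f(g)` is a unit; being
of finite order, it satisfies `f(g) ^ t = 1` for some `t > 0`, so `f(ζ) ^ t = 1` for `ζ` a primitive
`n`-th root of unity in `ℂ`, and `|f(ζ)| = 1` (`norm_aeval_eq_one_of_isPrimitiveRoot`). No appeal to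
Dirichlet's unit theorem is needed: it suffices to exhibit an `f` with `|f(ζ)| ≠ 1`.

* Suitable cyclotomic polynomials `f` show that no unit has order `8`, `9` or a prime `p ≥ 5`, so
  that all orders divide `12` (`orderOf_dvd_twelve`).
* If `u ^ 2 = -1` and `w ≠ 1` is a commuting unit with `w ^ 3 = 1`, the same argument for `g = u * w`
  and `n = 12` gives a contradiction (`eq_one_of_sq_eq_neg_one`).

A finite abelian unit group is therefore `(ℤ/2)^a × (ℤ/4)^b × (ℤ/3)^c`. It contains `-1 ≠ 1`, so
`a + b ≥ 1`; if `a = 0`, then `-1` is a square and `c = 0` (`exists_units_decomposition`).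

Conversely, `ℤ` and `ℤ[i]` have unit groups `ℤ/2` and `ℤ/4`, and the ring of tuples in `ℤ × ℤ[ω]^c`
whose coordinates all have the same residue modulo `1 - ω` has unit group `{±1} × μ₃^c`. Products
of these rings realize all the groups in the list (`exists_commRing`).
-/

section

open Polynomial

/-! ### Units given by integer polynomials in a unit -/

/-- If `Φₙ(g)` kills a nonzero element `D(g)` of a torsion-free ring, then every integer polynomial
vanishing at `g` is a multiple of `Φₙ`: otherwise `Φₙ` and `F` would generate an ideal of `ℤ[X]`
containing a nonzero integer, and that integer would kill `D(g)`. -/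
theorem cyclotomic_dvd_of_aeval_eq_zero {A : Type*} [Ring A] [IsAddTorsionFree A] {g : A} {n : ℕ}
    (hn : 0 < n) {D F : ℤ[X]} (hD : aeval g D ≠ 0) (h : aeval g (cyclotomic n ℤ * D) = 0)
    (hF : aeval g F = 0) : cyclotomic n ℤ ∣ F := by
  by_contra hdvd
  have hprime : Prime (cyclotomic n ℤ) := (cyclotomic.irreducible hn).prime
  have : IsDomain (AdjoinRoot (cyclotomic n ℤ)) := AdjoinRoot.isDomain_of_prime hprime
  have : Module.Finite ℤ (AdjoinRoot (cyclotomic n ℤ)) := (cyclotomic.monic n ℤ).finite_adjoinRoot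
  -- `ℤ[X] / (Φₙ)` is an integral domain, integral over `ℤ`, so its nonzero ideal `(F)` contains a
  -- nonzero integer `c`.
  have hx : AdjoinRoot.mk (cyclotomic n ℤ) F ≠ 0 := fun h0 => hdvd (AdjoinRoot.mk_eq_zero.1 h0)
  have hbot := Ideal.comap_ne_bot_of_integral_mem (R := ℤ) hx
    (Ideal.mem_span_singleton_self _) (Algebra.IsIntegral.isIntegral _)
  obtain ⟨c, hc, hc0⟩ := Submodule.exists_mem_ne_zero_of_ne_bot hbot
  obtain ⟨y, hy⟩ := Ideal.mem_span_singleton'.1 (Ideal.mem_comap.1 hc)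
  obtain ⟨H, rfl⟩ := AdjoinRoot.mk_surjective y
  have hdiv : cyclotomic n ℤ ∣ C c - H * F := by
    rw [← AdjoinRoot.mk_eq_zero, map_sub, map_mul, hy]
    simp
  obtain ⟨Q, hQ⟩ := hdiv
  have key : C c * D = Q * (cyclotomic n ℤ * D) + H * D * F := by
    linear_combination D * hQ
  have := congrArg (aeval g) key
  rw [map_add, map_mul, map_mul, map_mul _ _ F, h, hF, mul_zero, mul_zero, add_zero, aeval_C] at this
  simp only [algebraMap_int_eq, eq_intCast, ← zsmul_eq_mul] at this
  exact hD ((IsAddTorsionFree.zsmul_eq_zero_iff_right hc0).1 this)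

/-- A polynomial `f` coprime to one that vanishes at `g` gives a unit `f(g)`, here of finite order. If
`Φₙ(g)` kills a nonzero element `D(g)`, then the values of `f` at the roots of `Φₙ` are roots of
unity too, hence of norm `1`. -/
theorem norm_aeval_eq_one_of_isPrimitiveRoot {A : Type*} [Ring A] [IsAddTorsionFree A]
    [Finite Aˣ] {g : A} {n : ℕ}
    (hn : 0 < n) {D f P : ℤ[X]} (hD : aeval g D ≠ 0) (h : aeval g (cyclotomic n ℤ * D) = 0)
    (hP : aeval g P = 0) (hf : IsCoprime f P) {ζ : ℂ} (hζ : IsPrimitiveRoot ζ n) :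
    ‖aeval ζ f‖ = 1 := by
  have hu : IsUnit (aeval g f) := by
    obtain ⟨a, b, hab⟩ := hf
    have h1 := congrArg (aeval g) hab
    rw [map_add, map_mul, map_mul, hP, mul_zero, add_zero, map_one] at h1
    have h2 : aeval g f * aeval g a = 1 := by rw [← map_mul, mul_comm, map_mul, h1]
    exact ⟨⟨_, _, h2, h1⟩, rfl⟩
  obtain ⟨v, hv⟩ := hu
  obtain ⟨t, ht, hvt⟩ := isOfFinOrder_iff_pow_eq_one.1 (isOfFinOrder_of_finite v)
  have hF : aeval g (f ^ t - 1) = 0 := by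
    rw [map_sub, map_pow, ← hv, ← Units.val_pow_eq_pow_val, hvt]; simp
  obtain ⟨Q, hQ⟩ := cyclotomic_dvd_of_aeval_eq_zero hn hD h hF
  have h0 : aeval ζ (cyclotomic n ℤ) = 0 := by
    rw [aeval_def, ← eval_map, map_cyclotomic]
    exact hζ.isRoot_cyclotomic hn
  have h1 := congrArg (aeval ζ) hQ
  rw [map_mul, h0, zero_mul, map_sub, map_pow, map_one, sub_eq_zero] at h1
  exact Complex.norm_eq_one_of_pow_eq_one h1 ht.ne'

/-- Modulo `q` one has `X ^ m = 1`; if also `X ^ n = 1` with `n` prime to `m`, then `X = 1`. So it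
suffices to check coprimality of `q` with `X - 1`. -/
theorem isCoprime_X_pow_sub_one_of_dvd {q : ℤ[X]} {m n : ℕ} (hq : q ∣ X ^ m - 1)
    (h1 : IsCoprime q (X - 1)) (hmn : Nat.Coprime m n) (hn : 1 < n) : IsCoprime q (X ^ n - 1) := by
  obtain ⟨a, ha⟩ := Nat.exists_mul_mod_eq_one_of_coprime hmn hn
  obtain ⟨b, hb⟩ : (X ^ m - 1 : ℤ[X]) ∣ X ^ (m * a) - 1 := by
    rw [pow_mul]; exact sub_one_dvd_pow_sub_one _ _
  obtain ⟨c, hc⟩ : (X ^ n - 1 : ℤ[X]) ∣ X ^ (n * (m * a / n)) - 1 := by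
    rw [pow_mul]; exact sub_one_dvd_pow_sub_one _ _
  obtain ⟨d, hd⟩ := hq
  obtain ⟨r, s, hrs⟩ := h1
  have hX : (X : ℤ[X]) ^ (m * a) = X ^ (n * (m * a / n)) * X := by
    conv_lhs => rw [← Nat.div_add_mod (m * a) n, ha.2]
    rw [pow_add, pow_one]
  refine ⟨r + s * d * b, -s * X * c, ?_⟩
  linear_combination hrs + s * (-hb - b * hd + X * hc + hX)

/-- The point `z` of argument `θ` on the unit circle is a root of `X ^ 2 - 2 cos θ X + 1`. This
allows the value at `z` of a palindromic polynomial of degree `2 * k` to be written as `z ^ k` times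
a real polynomial in `cos θ`. -/
theorem exp_mul_I_sq (θ : ℝ) : Complex.exp (θ * Complex.I) ^ 2 =
    2 * (Real.cos θ : ℂ) * Complex.exp (θ * Complex.I) - 1 := by
  have h := Complex.sin_sq_add_cos_sq θ
  rw [Complex.exp_mul_I, Complex.ofReal_cos]
  linear_combination -h + Complex.sin θ ^ 2 * Complex.I_sq

theorem isPrimitiveRoot_exp_mul_I (n : ℕ) (hn : n ≠ 0) :
    IsPrimitiveRoot (Complex.exp ((2 * Real.pi / n : ℝ) * Complex.I)) n := by
  convert Complex.isPrimitiveRoot_exp n hn using 2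
  push_cast; ring

/-! ### Orders of units in a torsion-free ring -/

theorem norm_exp_pow_mul (θ r : ℝ) (k : ℕ) :
    ‖Complex.exp (θ * Complex.I) ^ k * (r : ℂ)‖ = |r| := by
  rw [norm_mul, norm_pow, Complex.norm_exp_ofReal_mul_I, one_pow, one_mul, Complex.norm_real,
    Real.norm_eq_abs]

/-- Let `n = p ^ (k + 1)`. If some polynomial `f` that is invertible modulo `X ^ n - 1` has a value
off the unit circle at `exp (2πi / n)`, then `n` is not the order of a unit `g`, because `f(g)` would
be a unit of infinite order. -/
theorem orderOf_ne_prime_pow {A : Type*} [Ring A] [IsAddTorsionFree A] [Finite Aˣ] {p k m : ℕ}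
    (hp : p.Prime) {f : ℤ[X]} (hf : f ∣ X ^ m - 1) (h1 : IsCoprime f (X - 1))
    (hm : Nat.Coprime m (p ^ (k + 1)))
    (hnorm : ‖aeval (Complex.exp ((2 * Real.pi / (p ^ (k + 1) : ℕ) : ℝ) * Complex.I)) f‖ ≠ 1)
    (g : Aˣ) : orderOf g ≠ p ^ (k + 1) := by
  intro hg
  have : Fact p.Prime := ⟨hp⟩
  have hP : aeval (g : A) (X ^ p ^ (k + 1) - 1 : ℤ[X]) = 0 := by
    have := pow_orderOf_eq_one g
    rw [hg] at this
    simp [← Units.val_pow_eq_pow_val, this]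
  have hD : aeval (g : A) (X ^ p ^ k - 1 : ℤ[X]) ≠ 0 := by
    intro h
    have h2 : g ^ p ^ k = 1 := by
      ext
      simpa [sub_eq_zero] using h
    have h3 := Nat.le_of_dvd (pow_pos hp.pos k) (orderOf_dvd_of_pow_eq_one h2)
    rw [hg] at h3
    exact absurd h3 (not_le.2 (Nat.pow_lt_pow_right hp.one_lt k.lt_succ_self))
  -- `D = X ^ (p ^ k) - 1` is a complementary factor, since `Φₙ * D = X ^ n - 1`.
  refine hnorm (norm_aeval_eq_one_of_isPrimitiveRoot (pow_pos hp.pos (k + 1)) hD ?_ hP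
    (isCoprime_X_pow_sub_one_of_dvd hf h1 hm (Nat.one_lt_pow k.succ_ne_zero hp.one_lt))
    (isPrimitiveRoot_exp_mul_I _ (pow_pos hp.pos _).ne'))
  rw [cyclotomic_prime_pow_mul_X_pow_sub_one, hP]

section
variable {A : Type*} [Ring A] [IsAddTorsionFree A] [Finite Aˣ]

/-- Here `f = Φ₆`, of value `z (2 cos θ - 1)` at `z = exp (iθ)`, `θ = 2π / p`, and
`0 < cos θ < 1` for `p ≥ 5`. -/
theorem orderOf_ne_prime (g : Aˣ) {p : ℕ} (hp : p.Prime) (h5 : 5 ≤ p) : orderOf g ≠ p := by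
  have h := orderOf_ne_prime_pow (k := 0) (m := 6) (f := X ^ 2 - X + 1) hp
    ⟨(X ^ 3 - 1) * (X + 1), by ring⟩ ⟨1, -X, by ring⟩ ?_ ?_ g
  · simpa using h
  · rw [zero_add, pow_one, Nat.coprime_comm, Nat.Prime.coprime_iff_not_dvd hp]
    intro h6
    have := Nat.le_of_dvd (by norm_num) h6
    interval_cases p
    · revert h6; decide
    · revert hp; decide
  · rw [zero_add, pow_one]
    set θ : ℝ := 2 * Real.pi / p
    have hp5 : (5 : ℝ) ≤ p := by exact_mod_cast h5
    have hθ0 : 0 < θ := by positivity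
    have hθ1 : θ < Real.pi / 2 := by
      rw [div_lt_div_iff₀ (by linarith) two_pos]
      nlinarith [Real.pi_pos]
    have hc0 : 0 < Real.cos θ := Real.cos_pos_of_mem_Ioo ⟨by linarith, hθ1⟩
    have hc1 : Real.cos θ < 1 := by
      rw [← Real.cos_zero]
      exact Real.cos_lt_cos_of_nonneg_of_le_pi_div_two le_rfl hθ1.le hθ0
    have hval : aeval (Complex.exp (θ * Complex.I)) (X ^ 2 - X + 1 : ℤ[X]) =
        Complex.exp (θ * Complex.I) ^ 1 * ((2 * Real.cos θ - 1 : ℝ) : ℂ) := by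
      simp only [map_add, map_sub, map_pow, aeval_X, map_one]
      push_cast [-Complex.ofReal_cos]
      linear_combination exp_mul_I_sq θ
    rw [hval, norm_exp_pow_mul]
    refine (abs_lt.2 ⟨by linarith, by linarith⟩).ne

/-- Here `f = Φ₁₀`, of value `z ^ 2 (4 cos ^ 2 θ - 2 cos θ - 1)` at `z = exp (iθ)`, `θ = 2π / 9`,
and `√2 / 2 < cos θ < 1`. -/
theorem orderOf_ne_nine (g : Aˣ) : orderOf g ≠ 9 := by
  have h := orderOf_ne_prime_pow (p := 3) (k := 1) (m := 10) (f := X ^ 4 - X ^ 3 + X ^ 2 - X + 1)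
    Nat.prime_three ⟨(X ^ 5 - 1) * (X + 1), by ring⟩ ⟨1, -X ^ 3 - X, by ring⟩ (by norm_num) ?_ g
  · simpa using h
  · set θ : ℝ := 2 * Real.pi / (3 ^ (1 + 1) : ℕ) with hθ
    have hθ0 : 0 < θ := by positivity
    have hθ1 : θ < Real.pi / 4 := by
      rw [hθ]; norm_num; linarith [Real.pi_pos]
    have hc0 : √2 / 2 < Real.cos θ := by
      rw [← Real.cos_pi_div_four]
      exact Real.cos_lt_cos_of_nonneg_of_le_pi_div_two hθ0.le (by linarith [Real.pi_pos]) hθ1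
    have hc1 : Real.cos θ < 1 := by
      rw [← Real.cos_zero]
      exact Real.cos_lt_cos_of_nonneg_of_le_pi_div_two le_rfl (by linarith [Real.pi_pos]) hθ0
    have hs : (1 : ℝ) < √2 := Real.lt_sqrt_of_sq_lt (by norm_num)
    have hval : aeval (Complex.exp (θ * Complex.I)) (X ^ 4 - X ^ 3 + X ^ 2 - X + 1 : ℤ[X]) =
        Complex.exp (θ * Complex.I) ^ 2 *
          ((4 * Real.cos θ ^ 2 - 2 * Real.cos θ - 1 : ℝ) : ℂ) := by
      simp only [map_add, map_sub, map_pow, aeval_X, map_one]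
      push_cast [-Complex.ofReal_cos]
      generalize hz : Complex.exp (θ * Complex.I) = z
      have := exp_mul_I_sq θ
      rw [hz] at this
      linear_combination (z ^ 2 + 2 * Real.cos θ * z + 1 - z) * this
    rw [hval, norm_exp_pow_mul]
    refine (abs_lt.2 ⟨by nlinarith, by nlinarith⟩).ne

/-- Here `f = Φ₁₅`, whose value at `z = exp (iπ / 4)` is `z ^ 4 (2√2 - 3)`. -/
theorem orderOf_ne_eight (g : Aˣ) : orderOf g ≠ 8 := by
  have h := orderOf_ne_prime_pow (p := 2) (k := 2) (m := 15)
    (f := X ^ 8 - X ^ 7 + X ^ 5 - X ^ 4 + X ^ 3 - X + 1)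
    Nat.prime_two ⟨(X ^ 5 - 1) * (X ^ 2 + X + 1), by ring⟩
    ⟨1, -X ^ 7 - X ^ 4 - X ^ 2 - X, by ring⟩ (by norm_num) ?_ g
  · simpa using h
  · have hθ : (2 * Real.pi / (2 ^ (2 + 1) : ℕ) : ℝ) = Real.pi / 4 := by norm_num; ring
    rw [hθ]
    set θ : ℝ := Real.pi / 4 with hθ'
    have hs : (√2) ^ 2 = 2 := Real.sq_sqrt (by norm_num)
    have hsC : ((√2 : ℝ) : ℂ) ^ 2 = 2 := by exact_mod_cast hs
    have hval : aeval (Complex.exp (θ * Complex.I))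
        (X ^ 8 - X ^ 7 + X ^ 5 - X ^ 4 + X ^ 3 - X + 1 : ℤ[X]) =
        Complex.exp (θ * Complex.I) ^ 4 * ((2 * √2 - 3 : ℝ) : ℂ) := by
      simp only [map_add, map_sub, map_pow, aeval_X, map_one]
      generalize hz : Complex.exp (θ * Complex.I) = z
      have h2 := exp_mul_I_sq θ
      rw [hz, hθ', Real.cos_pi_div_four] at h2
      push_cast at h2 ⊢
      have h3 : z ^ 2 = √2 * z - 1 := by linear_combination h2
      have h4 : z ^ 4 = -1 := by
        linear_combination (z ^ 2 + √2 * z + 1) * h3 + z ^ 2 * hsC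
      have h5 : z ^ 3 = z - √2 := by
        linear_combination (z + √2) * h3 + z * hsC
      linear_combination (z ^ 4 - z ^ 3 + z - 2 * √2 + 1) * h4 + 2 * h5
    rw [hval, norm_exp_pow_mul]
    have h1 : (1 : ℝ) < √2 := Real.lt_sqrt_of_sq_lt (by norm_num)
    have h2 : √2 < (2 : ℝ) := by nlinarith
    refine (abs_lt.2 ⟨by linarith, by nlinarith⟩).ne

theorem orderOf_dvd_twelve (g : Aˣ) : orderOf g ∣ 12 := by
  have ho := orderOf_pos g
  have key : ∀ d, d ∣ orderOf g → ∃ h : Aˣ, orderOf h = d := fun d hd =>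
    ⟨_, orderOf_pow_orderOf_div ho.ne' hd⟩
  rw [Nat.dvd_iff_prime_pow_dvd_dvd]
  intro p k hp hk
  have hle : ∀ j, j ≤ k → p ^ j ∣ orderOf g := fun j hj => (pow_dvd_pow p hj).trans hk
  by_cases h5 : 5 ≤ p
  · rcases Nat.eq_zero_or_pos k with rfl | hk0
    · simp
    · obtain ⟨h, hh⟩ := key p (by simpa using hle 1 hk0)
      exact absurd hh (orderOf_ne_prime h hp h5)
  · have hp2 := hp.two_le
    interval_cases p
    · have hk2 : k ≤ 2 := by
        by_contra! h3
        obtain ⟨h, hh⟩ := key _ (hle 3 h3)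
        exact orderOf_ne_eight h hh
      interval_cases k <;> norm_num
    · have hk2 : k ≤ 1 := by
        by_contra! h3
        obtain ⟨h, hh⟩ := key _ (hle 2 h3)
        exact orderOf_ne_nine h hh
      interval_cases k <;> norm_num
    · exact absurd hp (by norm_num)

/-- If `-1` is the square of a unit `u`, then no unit `w` of order `3` commutes with `u`. With
`g = u * w` one has `g ^ 6 = -1`, `Φ₁₂(g)` kills `g ^ 2 + 1 ≠ 0`, and `Φ₅(g)` is a unit, because
modulo `Φ₅` the equation `X ^ 6 = -1` forces `X = -1`, and `Φ₅(-1) = 1`. But `Φ₅` takes a value of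
modulus `2 + √3` at `exp (iπ / 6)`. -/
theorem eq_one_of_sq_eq_neg_one {u w : Aˣ} (hc : Commute u w) (hu : u ^ 2 = -1) (hw : w ^ 3 = 1) :
    w = 1 := by
  by_contra hw1
  set g : Aˣ := u * w with hg
  have hu4 : u ^ 4 = 1 := by rw [show 4 = 2 * 2 from rfl, pow_mul, hu]; simp
  have hg4 : g ^ 4 = w := by
    rw [hg, hc.mul_pow, hu4, one_mul, pow_succ, hw, one_mul]
  have hg6 : g ^ 6 = -1 := by
    rw [hg, hc.mul_pow, show 6 = 2 * 3 from rfl, pow_mul, hu, mul_comm 2, pow_mul w, hw]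
    simp [Odd.neg_one_pow (by decide : Odd 3)]
  have hP : aeval (g : A) (X ^ 6 + 1 : ℤ[X]) = 0 := by
    simp [← Units.val_pow_eq_pow_val, hg6]
  have hD : aeval (g : A) (X ^ 2 + 1 : ℤ[X]) ≠ 0 := by
    intro h
    have h2 : g ^ 2 = -1 := by
      ext
      simpa [add_eq_zero_iff_eq_neg] using h
    apply hw1
    rw [← hg4, show 4 = 2 * 2 from rfl, pow_mul, h2]; simp
  have h12 : (cyclotomic 12 ℤ) = X ^ 4 - X ^ 2 + 1 := by
    rw [show 12 = 6 * 2 from rfl, ← cyclotomic_expand_eq_cyclotomic Nat.prime_two (by norm_num),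
      cyclotomic_six]
    simp [← pow_mul]
  have hcop : IsCoprime (X ^ 4 + X ^ 3 + X ^ 2 + X + 1 : ℤ[X]) (X ^ 6 + 1) :=
    ⟨1 + (X - 1) * X * (X ^ 3 + X), -(X ^ 3 + X), by ring⟩
  have h := norm_aeval_eq_one_of_isPrimitiveRoot (by norm_num) hD
    (by rw [h12, ← hP]; congr 1; ring) hP hcop (isPrimitiveRoot_exp_mul_I 12 (by norm_num))
  revert h
  have hθ : (2 * Real.pi / (12 : ℕ) : ℝ) = Real.pi / 6 := by norm_num; ring
  rw [hθ]
  set θ : ℝ := Real.pi / 6 with hθ'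
  have hs : (√3) ^ 2 = 3 := Real.sq_sqrt (by norm_num)
  have hsC : ((√3 : ℝ) : ℂ) ^ 2 = 3 := by exact_mod_cast hs
  have hval : aeval (Complex.exp (θ * Complex.I)) (X ^ 4 + X ^ 3 + X ^ 2 + X + 1 : ℤ[X]) =
      Complex.exp (θ * Complex.I) ^ 2 * ((2 + √3 : ℝ) : ℂ) := by
    simp only [map_add, map_pow, aeval_X, map_one]
    generalize hz : Complex.exp (θ * Complex.I) = z
    have h2 := exp_mul_I_sq θ
    rw [hz, hθ', Real.cos_pi_div_six] at h2
    push_cast at h2 ⊢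
    linear_combination (z ^ 2 + √3 * z + 1 + z) * h2 + z ^ 2 * hsC
  rw [hval, norm_exp_pow_mul]
  have h1 : (0 : ℝ) < √3 := Real.sqrt_pos.2 (by norm_num)
  rw [abs_of_pos (by linarith)]
  intro h
  linarith
end

end

/-! ### The structure of finite abelian unit groups -/

theorem exists_decomposition {ι : Type*} [Fintype ι] (q : ι → ℕ)
    (hq : ∀ i, q i = 1 ∨ q i = 2 ∨ q i = 4 ∨ q i = 3) :
    ∃ a b c : ℕ, Nonempty ((∀ i, ZMod (q i)) ≃+
      (Fin a → ZMod 2) × (Fin b → ZMod 4) × (Fin c → ZMod 3)) := by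
  classical
  -- The summands isomorphic to `ℤ/m`, and the restriction to the corresponding coordinates.
  let e (m : ℕ) : (∀ i : {i // q i = m}, ZMod (q i)) ≃+
      (Fin (Fintype.card {i // q i = m}) → ZMod m) :=
    (AddEquiv.piCongrRight fun i => (ZMod.ringEquivCongr i.2).toAddEquiv).trans
      (AddEquiv.arrowCongr (Fintype.equivFin _) (AddEquiv.refl _))
  let res (m : ℕ) : (∀ i, ZMod (q i)) →+ (∀ i : {i // q i = m}, ZMod (q i)) :=
    { toFun := fun f i => f i
      map_zero' := rfl
      map_add' := fun _ _ => rfl }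
  let F : (∀ i, ZMod (q i)) →+ (∀ i : {i // q i = 2}, ZMod (q i)) ×
    (∀ i : {i // q i = 4}, ZMod (q i)) × (∀ i : {i // q i = 3}, ZMod (q i)) :=
    (res 2).prod ((res 4).prod (res 3))
  have hF : Function.Bijective F := by
    constructor
    · intro f g hfg
      have h2 := congrArg Prod.fst hfg
      have h4 := congrArg (fun x => x.2.1) hfg
      have h3 := congrArg (fun x => x.2.2) hfg
      funext i
      rcases hq i with h | h | h | h
      · have : Subsingleton (ZMod (q i)) := by rw [h]; infer_instance
        exact Subsingleton.elim _ _
      · exact congrFun h2 ⟨i, h⟩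
      · exact congrFun h4 ⟨i, h⟩
      · exact congrFun h3 ⟨i, h⟩
    · rintro ⟨x, y, z⟩
      refine ⟨fun i => if h : q i = 2 then x ⟨i, h⟩ else if h : q i = 4 then y ⟨i, h⟩ else
        if h : q i = 3 then z ⟨i, h⟩ else 0, ?_⟩
      refine Prod.ext ?_ (Prod.ext ?_ ?_) <;> funext i <;> obtain ⟨i, h⟩ := i <;> simp [F, res, h]
  exact ⟨_, _, _, ⟨(AddEquiv.ofBijective F hF).trans
    ((e 2).prodCongr ((e 4).prodCongr (e 3)))⟩⟩

theorem exists_decomposition_of_pow_twelve (G : Type*) [CommGroup G] [Finite G]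
    (h : ∀ g : G, g ^ 12 = 1) :
    ∃ a b c : ℕ, Nonempty (G ≃* Multiplicative
      ((Fin a → ZMod 2) × (Fin b → ZMod 4) × (Fin c → ZMod 3))) := by
  classical
  obtain ⟨ι, _, p, hp, e, ⟨φ⟩⟩ := AddCommGroup.equiv_directSum_zmod_of_finite (Additive G)
  let ψ := φ.trans (DirectSum.addEquivProd (fun i => ZMod (p i ^ e i)))
  have hq : ∀ i, p i ^ e i ∣ 12 := by
    intro i
    have h1 : (12 : ℕ) • (ψ.symm (Pi.single i 1)) = 0 := h _
    rw [← map_nsmul, AddEquiv.map_eq_zero_iff] at h1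
    have h2 := congrFun h1 i
    simp only [Pi.smul_apply, Pi.single_eq_same, Pi.zero_apply, nsmul_eq_mul, mul_one] at h2
    exact (ZMod.natCast_eq_zero_iff _ _).1 h2
  obtain ⟨a, b, c, ⟨χ⟩⟩ := exists_decomposition (fun i => p i ^ e i) (by
    intro i
    have h12 := hq i
    have h6 : ¬ 6 ∣ p i ^ e i := by
      intro h6
      have h2 : 2 ∣ p i ^ e i := by omega
      have h3 : 3 ∣ p i ^ e i := by omega
      have e2 := (Nat.prime_dvd_prime_iff_eq Nat.prime_two (hp i)).1
        (Nat.prime_two.dvd_of_dvd_pow h2)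
      have e3 := (Nat.prime_dvd_prime_iff_eq Nat.prime_three (hp i)).1
        (Nat.prime_three.dvd_of_dvd_pow h3)
      omega
    have hle := Nat.le_of_dvd (by norm_num) h12
    generalize p i ^ e i = q at *
    interval_cases q <;> omega)
  exact ⟨a, b, c, ⟨AddEquiv.toMultiplicativeRight (ψ.trans χ)⟩⟩

/-- The orders of units divide `12`, which gives the shape of the decomposition. The `2`-part is
nontrivial because of `-1`, and if it were homogeneous of exponent `4`, then `-1` would be a square,
which excludes elements of order `3`. -/
theorem exists_units_decomposition {A G : Type*} [Ring A] [Nontrivial A] [IsAddTorsionFree A]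
    [CommGroup G] [Finite G] (φ : Aˣ ≃* G) :
    ∃ a b c : ℕ, 1 ≤ a + b ∧ (1 ≤ c → 1 ≤ a) ∧ Nonempty (G ≃* Multiplicative
      ((Fin a → ZMod 2) × (Fin b → ZMod 4) × (Fin c → ZMod 3))) := by
  have : Finite Aˣ := Finite.of_equiv G φ.symm.toEquiv
  have hcomm : ∀ x y : Aˣ, Commute x y := fun x y => φ.injective (by simp [mul_comm])
  have hneg : (-1 : Aˣ) ≠ 1 := by
    intro h
    exact self_ne_neg.2 (one_ne_zero (α := A)) (by simpa using (congrArg Units.val h).symm)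
  obtain ⟨a, b, c, ⟨e⟩⟩ := exists_decomposition_of_pow_twelve G (fun g => by
    rw [← φ.apply_symm_apply g, ← map_pow,
      orderOf_dvd_iff_pow_eq_one.1 (orderOf_dvd_twelve (φ.symm g)), map_one])
  let E := φ.trans e
  refine ⟨a, b, c, ?_, ?_, ⟨e⟩⟩
  · by_contra! hab
    obtain ⟨rfl, rfl⟩ : a = 0 ∧ b = 0 := by omega
    have h3 : (-1 : Aˣ) ^ 3 = 1 := by
      apply E.injective
      rw [map_pow, map_one]
      apply Multiplicative.toAdd.injective
      refine Prod.ext (Subsingleton.elim _ _) (Prod.ext (Subsingleton.elim _ _) ?_)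
      funext i
      exact (by decide : ∀ z : ZMod 3, 3 • z = 0) _
    exact hneg (by simpa [Odd.neg_one_pow (by decide : Odd 3)] using h3)
  · intro hc
    by_contra! ha
    obtain rfl : a = 0 := by omega
    let m := (E (-1)).toAdd
    have hm : 2 • m = 0 := by
      change (E (-1) ^ 2).toAdd = 0
      rw [← map_pow]; simp
    -- Elements of `ℤ/4` killed by `2` are doubles, and `ℤ/3` has no nonzero such element, so `-1`
    -- is a square.
    choose v hv using (by decide : ∀ y : ZMod 4, 2 • y = 0 → ∃ v, 2 • v = y)
    let u : Aˣ := E.symm (.ofAdd (0, fun i => v (m.2.1 i)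
      (congrFun (congrArg (fun x => x.2.1) hm) i), 0))
    have hu : u ^ 2 = -1 := by
      apply E.injective
      rw [map_pow, E.apply_symm_apply]
      apply Multiplicative.toAdd.injective
      refine Prod.ext (Subsingleton.elim _ _) (Prod.ext ?_ ?_)
      · funext i
        exact hv _ _
      · funext i
        have := congrFun (congrArg (fun x => x.2.2) hm) i
        exact (by decide : ∀ z : ZMod 3, 2 • z = 0 → 2 • (0 : ZMod 3) = z) _ this
    let w : Aˣ := E.symm (.ofAdd (0, 0, fun _ => 1))
    have hw : w ^ 3 = 1 := by
      apply E.injective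
      rw [map_pow, E.apply_symm_apply, map_one]
      apply Multiplicative.toAdd.injective
      refine Prod.ext (Subsingleton.elim _ _) (Prod.ext ?_ ?_)
      · funext i
        exact (by decide : 3 • (0 : ZMod 4) = 0)
      · funext i
        exact (by decide : 3 • (1 : ZMod 3) = 0)
    have hw1 := eq_one_of_sq_eq_neg_one (hcomm u w) hu hw
    have := congrArg E hw1
    rw [E.apply_symm_apply, map_one] at this
    have := congrFun (congrArg (fun x => x.2.2) (congrArg Multiplicative.toAdd this)) ⟨0, hc⟩
    exact absurd this (by decide : (1 : ZMod 3) ≠ 0)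

/-! ### Construction of rings with prescribed units -/

theorem nonempty_mulEquiv_zmod {G : Type*} [Group G] (g : G) (n : ℕ) (hn : orderOf g = n)
    (h : ∀ x, x ∈ Subgroup.zpowers g) : Nonempty (G ≃* Multiplicative (ZMod n)) := by
  have hc : Nat.card G = n := by rw [← hn, orderOf_eq_card_of_forall_mem_zpowers h]
  have : IsCyclic G := ⟨g, h⟩
  rw [← hc]
  exact ⟨(zmodCyclicMulEquiv this).symm⟩

theorem nonempty_units_int_mulEquiv : Nonempty (ℤˣ ≃* Multiplicative (ZMod 2)) := by
  refine nonempty_mulEquiv_zmod (-1) 2 (orderOf_eq_prime (by simp) (by decide)) fun x => ?_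
  rcases Int.units_eq_one_or x with rfl | rfl
  · exact one_mem _
  · exact Subgroup.mem_zpowers _

/-- The Gaussian integers `ℤ[i]`, as the quadratic algebra over `ℤ` in which `i ^ 2 = -1`. -/
abbrev GaussianIntegers := QuadraticAlgebra ℤ (-1) 0

/-- The Eisenstein integers `ℤ[ω]`, as the quadratic algebra over `ℤ` in which `ω ^ 2 = -1 - ω`, so
that `ω` is a primitive cube root of unity. -/
abbrev EisensteinIntegers := QuadraticAlgebra ℤ (-1) (-1)

instance instIsAddTorsionFreeQuadraticAlgebra (a b : ℤ) :
    IsAddTorsionFree (QuadraticAlgebra ℤ a b) :=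
  Module.isTorsionFree_int_iff_isAddTorsionFree.1 inferInstance

namespace GaussianIntegers

/-- The unit `i` of `ℤ[i]`, with inverse `-i`. -/
def iUnit : GaussianIntegersˣ := ⟨⟨0, 1⟩, ⟨0, -1⟩, by decide, by decide⟩

theorem nonempty_units_mulEquiv : Nonempty (GaussianIntegersˣ ≃* Multiplicative (ZMod 4)) := by
  refine nonempty_mulEquiv_zmod iUnit 4
    (orderOf_eq_prime_pow (p := 2) (n := 1) (by decide) (by decide)) fun x => ?_
  have hx := (Int.isUnit_iff_abs_eq.1 (QuadraticAlgebra.isUnit_iff_norm_isUnit.1 x.isUnit))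
  obtain ⟨⟨a, b⟩, y, h1, h2⟩ := x
  rw [QuadraticAlgebra.norm_def] at hx
  replace hx : a * a + b * b = 1 := by
    ring_nf at hx ⊢
    rwa [abs_of_nonneg (by positivity)] at hx
  have ha : a ≤ 1 := by nlinarith
  have ha' : -1 ≤ a := by nlinarith
  have hb : b ≤ 1 := by nlinarith
  have hb' : -1 ≤ b := by nlinarith
  have : ∃ k : ℕ, ((iUnit ^ k : GaussianIntegersˣ) : GaussianIntegers) = ⟨a, b⟩ := by
    interval_cases a <;> interval_cases b <;> norm_num at hx
    · exact ⟨2, by decide⟩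
    · exact ⟨3, by decide⟩
    · exact ⟨1, by decide⟩
    · exact ⟨0, by decide⟩
  obtain ⟨k, hk⟩ := this
  rw [← Units.ext (v := ⟨⟨a, b⟩, y, h1, h2⟩) hk]
  exact Subgroup.npow_mem_zpowers _ _

end GaussianIntegers

namespace EisensteinIntegers

/-- The unit `ω` of `ℤ[ω]`, with inverse `ω ^ 2 = -1 - ω`. -/
def omegaUnit : EisensteinIntegersˣ := ⟨⟨0, 1⟩, ⟨-1, -1⟩, by decide, by decide⟩

/-- Reduction of `ℤ[ω]` modulo the prime `1 - ω` above `3`; it sends `ω` to `1`. -/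
def residue : EisensteinIntegers →+* ZMod 3 where
  toFun z := z.re + z.im
  map_zero' := by simp
  map_one' := by simp [QuadraticAlgebra.re_one, QuadraticAlgebra.im_one]
  map_add' x y := by simp; ring
  map_mul' x y := by
    simp only [QuadraticAlgebra.re_mul, QuadraticAlgebra.im_mul]
    push_cast
    have : (3 : ZMod 3) = 0 := rfl
    linear_combination (-(x.im : ZMod 3) * y.im) * this

/-- The units of `ℤ[ω]` congruent to `1` modulo `1 - ω`. They are the three cube roots of unity,
`-1` being excluded by the congruence. -/
def principalUnits : Subgroup EisensteinIntegersˣ := (Units.map residue.toMonoidHom).ker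

theorem mem_principalUnits {u : EisensteinIntegersˣ} :
    u ∈ principalUnits ↔ residue u = 1 := by
  simp [principalUnits, MonoidHom.mem_ker, Units.ext_iff]

theorem nonempty_principalUnits_mulEquiv :
    Nonempty (principalUnits ≃* Multiplicative (ZMod 3)) := by
  refine nonempty_mulEquiv_zmod ⟨omegaUnit, mem_principalUnits.2 (by decide)⟩ 3
    (orderOf_eq_prime (Subtype.ext (by decide : omegaUnit ^ 3 = 1))
      fun h => (by decide : omegaUnit ≠ 1) (congrArg Subtype.val h)) fun x => ?_
  obtain ⟨x, hx1⟩ := x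
  rw [mem_principalUnits] at hx1
  have hx := (Int.isUnit_iff_abs_eq.1 (QuadraticAlgebra.isUnit_iff_norm_isUnit.1 x.isUnit))
  have : ∃ k : ℕ, ((omegaUnit ^ k : EisensteinIntegersˣ) : EisensteinIntegers) = x := by
    generalize (x : EisensteinIntegers) = z at *
    obtain ⟨a, b⟩ := z
    simp only [QuadraticAlgebra.norm_def] at hx
    rw [abs_of_nonneg (by nlinarith [sq_nonneg (a - b)])] at hx
    -- `4 (a ^ 2 - a b + b ^ 2) = 3 a ^ 2 + (a - 2 b) ^ 2`, and symmetrically in `a` and `b`.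
    have ha : a ≤ 1 := by nlinarith [sq_nonneg (a - 2 * b)]
    have ha' : -1 ≤ a := by nlinarith [sq_nonneg (a - 2 * b)]
    have hb : b ≤ 1 := by nlinarith [sq_nonneg (2 * a - b)]
    have hb' : -1 ≤ b := by nlinarith [sq_nonneg (2 * a - b)]
    -- Six solutions remain; `-1`, `-ω` and `-ω ^ 2` have residue `-1`.
    interval_cases a <;> interval_cases b <;> norm_num at hx
    · exact ⟨2, by decide⟩
    · exact absurd hx1 (by decide)
    · exact absurd hx1 (by decide)
    · exact ⟨1, by decide⟩
    · exact ⟨0, by decide⟩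
    · exact absurd hx1 (by decide)
  obtain ⟨k, hk⟩ := this
  refine Subgroup.mem_zpowers_iff.2 ⟨k, ?_⟩
  ext1
  rw [zpow_natCast]
  exact Units.ext hk

/-- The subring of `ℤ × ℤ[ω] ^ c` of the tuples `(n, x₁, …, x_c)` with `xᵢ ≡ n` modulo `1 - ω` for
all `i`. The congruences make all the signs in a unit agree. -/
def congruenceSubring (c : ℕ) : Subring (ℤ × (Fin c → EisensteinIntegers)) where
  carrier := {x | ∀ i, residue (x.2 i) = x.1}
  mul_mem' hx hy i := by simp [hx i, hy i]
  one_mem' i := by simp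
  add_mem' hx hy i := by simp [hx i, hy i]
  zero_mem' i := by simp
  neg_mem' hx i := by simp [hx i]

theorem mem_congruenceSubring {c : ℕ} {x : ℤ × (Fin c → EisensteinIntegers)} :
    x ∈ congruenceSubring c ↔ ∀ i, residue (x.2 i) = x.1 := Iff.rfl

/-- The homomorphism `(n, x) ↦ (n, (xᵢ / n)ᵢ)` from the units of `congruenceSubring c` to
`{±1} × μ₃ ^ c`. -/
def unitsCongruenceSubring (c : ℕ) :
    (congruenceSubring c)ˣ →* ℤˣ × (Fin c → principalUnits) :=
  let n : (congruenceSubring c)ˣ →* ℤˣ :=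
    Units.map ((RingHom.fst _ _).comp (congruenceSubring c).subtype).toMonoidHom
  let x (i : Fin c) : (congruenceSubring c)ˣ →* EisensteinIntegersˣ :=
    Units.map (((Pi.evalRingHom _ i).comp (RingHom.snd _ _)).comp
      (congruenceSubring c).subtype).toMonoidHom
  n.prod (MonoidHom.pi fun i =>
    (x i / (Units.map (Int.castRingHom EisensteinIntegers).toMonoidHom).comp n).codRestrict
      principalUnits fun u => by
        rw [principalUnits, MonoidHom.mem_ker, MonoidHom.div_apply, map_div, div_eq_one]
        ext
        simpa [n, x] using mem_congruenceSubring.1 u.1.2 i)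

theorem unitsCongruenceSubring_bijective (c : ℕ) :
    Function.Bijective (unitsCongruenceSubring c) := by
  constructor
  · rw [injective_iff_map_eq_one]
    intro u hu
    have h1 := congrArg (fun p => ((p.1 : ℤˣ) : ℤ)) hu
    have hn := congrArg Prod.fst hu
    have h2 (i : Fin c) := congrArg (fun p => (p.2 i : EisensteinIntegersˣ)) hu
    ext1
    refine Subtype.ext (Prod.ext h1 (funext fun i => ?_))
    -- As the first coordinate is `1`, the quotient by its image is the coordinate `i` itself.
    have h3 : Units.map (((Pi.evalRingHom _ i).comp (RingHom.snd _ _)).comp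
        (congruenceSubring c).subtype).toMonoidHom u /
        Units.map (Int.castRingHom EisensteinIntegers).toMonoidHom
          (unitsCongruenceSubring c u).1 = 1 := h2 i
    rw [hn, Prod.fst_one, map_one, div_one] at h3
    exact congrArg Units.val h3
  · rintro ⟨n, y⟩
    let Y (i : Fin c) : EisensteinIntegersˣ :=
      Units.map (Int.castRingHom EisensteinIntegers).toMonoidHom n * y i
    have hY (i : Fin c) : Units.map residue.toMonoidHom (Y i) =
        Units.map (Int.castRingHom (ZMod 3)).toMonoidHom n := by
      ext
      simp [Y, mem_principalUnits.1 (y i).2]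
    refine ⟨⟨⟨(n, fun i => Y i), fun i => by simpa using congrArg Units.val (hY i)⟩,
      ⟨((n⁻¹ : ℤˣ), fun i => ((Y i)⁻¹ : EisensteinIntegersˣ)), fun i =>
        congrArg (fun z => ((z⁻¹ : (ZMod 3)ˣ) : ZMod 3)) (hY i)⟩,
      ?_, ?_⟩, ?_⟩
    · refine Subtype.ext (Prod.ext ?_ (funext fun i => ?_)) <;> simp
    · refine Subtype.ext (Prod.ext ?_ (funext fun i => ?_)) <;> simp
    · refine Prod.ext (Units.ext rfl) (funext fun i => Subtype.ext ?_)
      change Y i / Units.map (Int.castRingHom EisensteinIntegers).toMonoidHom n = y i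
      simp [Y]

end EisensteinIntegers

/-- For `a ≥ 1` the ring is `ℤ ^ (a - 1) × ℤ[i] ^ b × B`, where `B = congruenceSubring c` has unit
group `{±1} × μ₃ ^ c`; for `a = 0`, hence `c = 0`, it is `ℤ[i] ^ b`. -/
theorem exists_commRing (a b c : ℕ) (hab : 1 ≤ a + b) (hc : 1 ≤ c → 1 ≤ a) :
    ∃ (A : Type v) (_ : CommRing A), Nontrivial A ∧ IsAddTorsionFree A ∧
      Nonempty (Aˣ ≃* Multiplicative
        ((Fin a → ZMod 2) × (Fin b → ZMod 4) × (Fin c → ZMod 3))) := by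
  suffices h : ∃ (A : Type) (_ : CommRing A), Nontrivial A ∧ IsAddTorsionFree A ∧
      Nonempty (Aˣ ≃* (Fin a → Multiplicative (ZMod 2)) ×
        (Fin b → Multiplicative (ZMod 4)) × (Fin c → Multiplicative (ZMod 3))) by
    obtain ⟨A, _, _, _, ⟨e⟩⟩ := h
    refine ⟨ULift.{v} A, inferInstance, inferInstance, ?_,
      ⟨(Units.mapEquiv ULift.ringEquiv.toMulEquiv).trans (e.trans ?_)⟩⟩
    · exact ULift.down_injective.isAddTorsionFree AddEquiv.ulift.toAddMonoidHom
    · exact { Equiv.refl _ with map_mul' := fun _ _ => rfl }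
  obtain ⟨e2⟩ := nonempty_units_int_mulEquiv
  obtain ⟨e4⟩ := GaussianIntegers.nonempty_units_mulEquiv
  obtain ⟨e3⟩ := EisensteinIntegers.nonempty_principalUnits_mulEquiv
  let f4 : (Fin b → GaussianIntegers)ˣ ≃* (Fin b → Multiplicative (ZMod 4)) :=
    MulEquiv.piUnits.trans (MulEquiv.piCongrRight fun _ => e4)
  rcases Nat.eq_zero_or_pos a with rfl | ha
  · obtain rfl : c = 0 := by omega
    have : Nonempty (Fin b) := ⟨⟨0, by omega⟩⟩
    exact ⟨Fin b → GaussianIntegers, inferInstance, inferInstance, inferInstance,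
      ⟨f4.trans (MulEquiv.prodUnique.symm.trans MulEquiv.uniqueProd.symm)⟩⟩
  · obtain ⟨k, rfl⟩ : ∃ k, a = k + 1 := ⟨a - 1, by omega⟩
    let f2 : (Fin k → ℤ)ˣ ≃* (Fin k → Multiplicative (ZMod 2)) :=
      MulEquiv.piUnits.trans (MulEquiv.piCongrRight fun _ => e2)
    let f3 : (EisensteinIntegers.congruenceSubring c)ˣ ≃*
        Multiplicative (ZMod 2) × (Fin c → Multiplicative (ZMod 3)) :=
      (MulEquiv.ofBijective _ (EisensteinIntegers.unitsCongruenceSubring_bijective c)).trans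
        (e2.prodCongr (MulEquiv.piCongrRight fun _ => e3))
    let f : ((Fin k → ℤ) × (Fin b → GaussianIntegers) × EisensteinIntegers.congruenceSubring c)ˣ ≃*
        _ := MulEquiv.prodUnits.trans (f2.prodCongr (MulEquiv.prodUnits.trans (f4.prodCongr f3)))
    have : IsAddTorsionFree (EisensteinIntegers.congruenceSubring c) :=
      Subtype.val_injective.isAddTorsionFree
        (EisensteinIntegers.congruenceSubring c).subtype.toAddMonoidHom
    refine ⟨(Fin k → ℤ) × (Fin b → GaussianIntegers) × EisensteinIntegers.congruenceSubring c,
      inferInstance, inferInstance, Prod.instIsAddTorsionFree, ⟨f.trans ?_⟩⟩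
    exact
      { toFun := fun p => (Fin.cons p.2.2.1 p.1, p.2.1, p.2.2.2)
        invFun := fun p => (Fin.tail p.1, p.2.1, p.1 0, p.2.2)
        left_inv := fun p => by simp
        right_inv := fun p => by simp
        map_mul' := fun p q => by
          refine Prod.ext (funext fun i => ?_) rfl
          refine Fin.cases ?_ (fun i => ?_) i <;> rfl }

/-! ### The classification -/

theorem theorem4p1 :
    -- Which finite abelian groups are unit groups of (nonzero) torsion-free rings.
    (∀ (G : Type u) [CommGroup G] [Finite G],
      [ ∃ (A : Type v) (_ : Ring A),
          Nontrivial A ∧ IsAddTorsionFree A ∧ Nonempty (Aˣ ≃* G),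
        ∃ (A : Type v) (_ : CommRing A),
          Nontrivial A ∧ IsAddTorsionFree A ∧ Nonempty (Aˣ ≃* G),
        ∃ a b c : ℕ, 1 ≤ a + b ∧ (1 ≤ c → 1 ≤ a) ∧
          Nonempty (G ≃* Multiplicative
            ((Fin a → ZMod 2) × (Fin b → ZMod 4) × (Fin c → ZMod 3))) ].TFAE) ∧
    -- The possible orders of the unit group, when it is finite and abelian.
    (∀ n : ℕ,
      [ ∃ (A : Type v) (_ : Ring A),
          Nontrivial A ∧ IsAddTorsionFree A ∧ Finite Aˣ ∧ (∀ x y : Aˣ, x * y = y * x) ∧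
            Nat.card Aˣ = n,
        ∃ (A : Type v) (_ : CommRing A),
          Nontrivial A ∧ IsAddTorsionFree A ∧ Finite Aˣ ∧ Nat.card Aˣ = n,
        ∃ d c : ℕ, 1 ≤ d ∧ n = 2 ^ d * 3 ^ c ].TFAE) := by
  have hcard (a b c : ℕ) : Nat.card (Multiplicative
      ((Fin a → ZMod 2) × (Fin b → ZMod 4) × (Fin c → ZMod 3))) = 2 ^ (a + 2 * b) * 3 ^ c := by
    rw [Nat.card_congr Multiplicative.toAdd]
    simp [pow_add, pow_mul, mul_assoc]
  constructor
  · intro G _ _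
    tfae_have 2 → 1 := fun ⟨A, _, h⟩ => ⟨A, inferInstance, h⟩
    tfae_have 1 → 3 := fun ⟨A, _, _, _, ⟨φ⟩⟩ => exists_units_decomposition φ
    tfae_have 3 → 2 := by
      rintro ⟨a, b, c, hab, hc, ⟨e⟩⟩
      obtain ⟨A, _, h0, h1, ⟨f⟩⟩ := exists_commRing.{v} a b c hab hc
      exact ⟨A, _, h0, h1, ⟨f.trans e.symm⟩⟩
    tfae_finish
  · intro n
    tfae_have 2 → 1 := fun ⟨A, _, h0, h1, h2, h3⟩ =>
      ⟨A, inferInstance, h0, h1, h2, fun x y => mul_comm x y, h3⟩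
    tfae_have 1 → 3 := by
      rintro ⟨A, _, _, _, _, hcomm, rfl⟩
      let _ : CommGroup Aˣ := { (inferInstance : Group Aˣ) with mul_comm := hcomm }
      obtain ⟨a, b, c, hab, -, ⟨e⟩⟩ := exists_units_decomposition (MulEquiv.refl Aˣ)
      exact ⟨a + 2 * b, c, by omega, by rw [Nat.card_congr e.toEquiv, hcard]⟩
    tfae_have 3 → 2 := by
      rintro ⟨d, c, hd, rfl⟩
      obtain ⟨A, _, h0, h1, ⟨f⟩⟩ := exists_commRing.{v} d 0 c (by omega) fun _ => hd
      exact ⟨A, _, h0, h1, Finite.of_equiv _ f.symm.toEquiv, by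
        rw [Nat.card_congr f.toEquiv, hcard]; simp⟩
    tfae_finish
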